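/- For a complex $m\times n$ matrix $X$ let $F_X$ be the linear operator with matrix $X$ from $(\mathbb{C}^n,\|\cdot\|_\infty)$ to $(\mathbb{C}^m,\|\cdot\|_2)$, let $\|X\|_F$ be its operator norm, and let $\|X\|_{cbF}$ be its completely bounded norm, where $\mathbb{C}^n$ is regarded as the abelian C*-algebra $\mathcal{A}_n=C(\{1,\dots,n\},\mathbb{C})$ and $\mathbb{C}^m=M_{(m,1)}(\mathbb{C})$ as the column Hilbert space; that is, $$\|X\|_{cbF}=\sup_{k\in\mathbb{N}}\ \sup\Big\{\Big\|\Big(\sum_{j=1}^n X_{ij}A_j\Big)_{1\le i\le m}\Big\|_{M_{(mk,k)}(\mathbb{C})} : A_1,\dots,A_n\in M_k(\mathbb{C}),\ \max_j\|A_j\|\le 1\Big\}$$ (operator norms of matrices). The complex little Grothendieck constant $k_G^{\mathbb{C}}$ is the smallest positive real $\kappa$ such that $\|X\|_{cbF}\le\sqrt{\kappa}\,\|X\|_F$ for all $m,n$ and all complex $m\times n$ matrices $X$. For a natural number $n$ let $M_n(\mathbb{C})_+$ be the cone of positive semidefinite matrices in $M_n(\mathbb{C})$, let $\mathcal{Q}_n=\{X\in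 M_n(\mathbb{C}) : X\ge 0,\ \mathrm{diag}(X)=I_n\}$, and let $\mathcal{R}_n$ be the closed convex hull in $M_n(\mathbb{C})$ of the set of rank one matrices $(\overline{u_i}\,u_j)_{i,j}$ with $u=(u_1,\dots,u_n)$ unitary in $\mathcal{A}_n$, i.e. $u\in\mathbb{C}^n$ and $|u_i|=1$ for all $i$. **Theorem.** The constant $k_G^{\mathbb{C}}$ is the smallest positive real $\beta$ such that for every natural number $n$ and every real $\alpha\ge\beta$ $$\mathcal{Q}_n\subseteq \alpha\,\mathcal{R}_n-M_n(\mathbb{C})_+ .$$ -/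

import Mathlib

open scoped ComplexOrder Pointwise

noncomputable section

namespace LittleGrothendieck

/-- The operator `F_X` with matrix `X`, acting from `(ℂⁿ, ‖·‖_∞)` to `(ℂᵐ, ‖·‖₂)`. -/
def opF {m n : ℕ} (X : Matrix (Fin m) (Fin n) ℂ) :
    (Fin n → ℂ) →ₗ[ℂ] EuclideanSpace ℂ (Fin m) :=
  (WithLp.linearEquiv 2 ℂ (Fin m → ℂ)).symm.toLinearMap ∘ₗ X.mulVecLin

/-- `‖X‖_F`: the norm of `F_X` as an operator from `(ℂⁿ, ‖·‖_∞)` to `(ℂᵐ, ‖·‖₂)`. -/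
def normF {m n : ℕ} (X : Matrix (Fin m) (Fin n) ℂ) : ℝ :=
  ‖LinearMap.toContinuousLinearMap (opF X)‖

section CompletelyBounded

open scoped Matrix.Norms.L2Operator

/-- The `k`-th matrix amplification of `F_X`.  Its domain is `M_k(ℂⁿ)`, i.e. `n`-tuples
`A = (A₁, …, Aₙ)` of complex `k × k` matrices with the norm `max_j ‖A_j‖`.  Its values are
`k × k` matrices with entries in the column Hilbert space `ℂᵐ = M_{(m,1)}(ℂ)`, i.e. complex
`mk × k` matrices with the operator norm; the `i`-th `k × k` block of the value at `A`
is `∑ j, X i j • A j`. -/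
def ampF {m n : ℕ} (X : Matrix (Fin m) (Fin n) ℂ) (k : ℕ) :
    (Fin n → Matrix (Fin k) (Fin k) ℂ) →ₗ[ℂ] Matrix (Fin m × Fin k) (Fin k) ℂ where
  toFun A := Matrix.of fun p b => ∑ j, X p.1 j * A j p.2 b
  map_add' A B := by
    ext p b
    simp [mul_add, Finset.sum_add_distrib]
  map_smul' c A := by
    ext p b
    simp [Finset.mul_sum, mul_left_comm]

/-- The norm of the `k`-th matrix amplification of `F_X`. -/
def ampNormF {m n : ℕ} (X : Matrix (Fin m) (Fin n) ℂ) (k : ℕ) : ℝ :=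
  ‖LinearMap.toContinuousLinearMap (ampF X k)‖

/-- `‖X‖_{cbF}`: the completely bounded norm of `F_X`. -/
def normCbF {m n : ℕ} (X : Matrix (Fin m) (Fin n) ℂ) : ℝ :=
  ⨆ k : ℕ, ampNormF X k

/-- The supremum defining `‖X‖_{cbF}` is a genuine (finite) one. -/
theorem bddAbove_ampNormF {m n : ℕ} (X : Matrix (Fin m) (Fin n) ℂ) :
    BddAbove (Set.range (ampNormF X)) := by
  refine ⟨∑ i, ∑ j, ‖X i j‖, ?_⟩
  rintro _ ⟨k, rfl⟩
  refine ContinuousLinearMap.opNorm_le_bound _ (by positivity) fun A => ?_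
  let E : Fin m → Matrix (Fin m × Fin k) (Fin k) ℂ := fun i =>
    Matrix.of fun p b => if p.1 = i ∧ p.2 = b then 1 else 0
  have hE : ∀ i, ‖E i‖ ≤ 1 := by
    intro i
    have h1 : (E i).conjTranspose * E i = 1 := by
      ext a b
      rw [Matrix.mul_apply, Fintype.sum_prod_type, Finset.sum_eq_single i]
      · simp [E, Matrix.one_apply, eq_comm]
      · intro c _ hc
        simp [E, hc]
      · simp
    have h2 := Matrix.l2_opNorm_conjTranspose_mul_self (E i)
    have h3 : ‖(1 : Matrix (Fin k) (Fin k) ℂ)‖ ≤ 1 := by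
      rw [← Matrix.diagonal_one, Matrix.l2_opNorm_diagonal]
      exact (pi_norm_le_iff_of_nonneg zero_le_one).2 fun _ => by simp
    rw [h1] at h2
    nlinarith [norm_nonneg (E i)]
  have hA : ampF X k A = ∑ i, ∑ j, X i j • (E i * A j) := by
    ext p b
    simp only [Matrix.sum_apply, Matrix.smul_apply, Matrix.mul_apply]
    rw [Finset.sum_eq_single p.1]
    · simp [ampF, E]
    · intro c _ hc
      simp [E, hc.symm]
    · simp
  rw [LinearMap.coe_toContinuousLinearMap', hA, Finset.sum_mul]
  refine norm_sum_le_of_le _ fun i _ => ?_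
  rw [Finset.sum_mul]
  refine norm_sum_le_of_le _ fun j _ => ?_
  rw [norm_smul]
  refine mul_le_mul_of_nonneg_left ?_ (norm_nonneg _)
  calc ‖E i * A j‖ ≤ ‖E i‖ * ‖A j‖ := Matrix.l2_opNorm_mul _ _
    _ ≤ 1 * ‖A‖ := mul_le_mul (hE i) (norm_le_pi_norm A j) (norm_nonneg _) zero_le_one
    _ = ‖A‖ := one_mul _

end CompletelyBounded

/-- The complex little Grothendieck constant `k_G^ℂ`: the smallest positive `κ` such that
`‖X‖_{cbF} ≤ √κ ‖X‖_F` for all complex matrices `X` of all sizes. -/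
def kG : ℝ :=
  sInf {κ : ℝ | 0 < κ ∧ ∀ (m n : ℕ) (X : Matrix (Fin m) (Fin n) ℂ),
    normCbF X ≤ √κ * normF X}

/-- `M_n(ℂ)_+`: the cone of positive (semidefinite) complex `n × n` matrices. -/
def posCone (n : ℕ) : Set (Matrix (Fin n) (Fin n) ℂ) :=
  {P | P.PosSemidef}

/-- `Q_n`: the positive matrices with diagonal equal to the identity. -/
def setQ (n : ℕ) : Set (Matrix (Fin n) (Fin n) ℂ) :=
  {X | X.PosSemidef ∧ X.diag = 1}

/-- `R_n`: the closed convex hull of the rank one matrices `(u*)_| u_-`, with entries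
`conj (u i) * u j`, where `u` is a unitary of the C*-algebra `ℂⁿ`. -/
def setR (n : ℕ) : Set (Matrix (Fin n) (Fin n) ℂ) :=
  closedConvexHull ℝ
    {M | ∃ u ∈ unitary (Fin n → ℂ), M = Matrix.vecMulVec (star u) u}

end LittleGrothendieck

end

/-! Both norms are support functions, evaluated at `Xᴴ * X` under `pairing`. Every point of the disc
is a midpoint of two points of the circle, so `normF X ^ 2` is the supremum over `setR n`. Only the
vectors `A j x` matter in the amplification, so `normCbF X ^ 2` is the supremum over Gram matrices
`Bᴴ * B` with diagonal at most 1 (`energy_le_normCbF`, `normCbF_le_of_energy`), equivalently over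
`setQ n`.

Since every positive matrix has the form `Xᴴ * X`, the inequality with constant `α` says that no
positive functional separates a point of `setQ n` from `α • setR n - posCone n`. Pairing gives one
direction. The other is Hahn-Banach, as this set is convex and closed, and functionals bounded above
on it are positive.

It remains that `kG` itself is admissible (`kG_mem`), which needs some finite constant:
`normCbF_le_sqrt_mul_normF` gives 48. -/

namespace LittleGrothendieck

/-- The real part of the bilinear pairing `∑ j l, P j l * Q j l` of two complex matrices. -/
noncomputable def pairing {n : ℕ} (P : Matrix (Fin n) (Fin n) ℂ) : Matrix (Fin n) (Fin n) ℂ →ₗ[ℝ] ℝ where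
  toFun Q := (∑ j, ∑ l, P j l * Q j l).re
  map_add' Q Q' := by simp [mul_add, Finset.sum_add_distrib]
  map_smul' c Q := by simp [mul_left_comm, ← Finset.mul_sum, mul_sub]

theorem pairing_apply {n : ℕ} (P Q : Matrix (Fin n) (Fin n) ℂ) :
    pairing P Q = (∑ j, ∑ l, P j l * Q j l).re := rfl

theorem continuous_pairing {n : ℕ} (P : Matrix (Fin n) (Fin n) ℂ) : Continuous (pairing P) := by
  change Continuous fun Q : Matrix (Fin n) (Fin n) ℂ => (∑ j, ∑ l, P j l * Q j l).re
  fun_prop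

theorem exists_eq_conjTranspose_mul_self {n : ℕ} {Q : Matrix (Fin n) (Fin n) ℂ}
    (hQ : Q.PosSemidef) :
    ∃ (k : ℕ) (B : Matrix (Fin k) (Fin n) ℂ), Q = B.conjTranspose * B := by
  obtain ⟨k, v, hv⟩ := Matrix.posSemidef_iff_eq_sum_vecMulVec.1 hQ
  refine ⟨k, Matrix.of fun s => star (v s), ?_⟩
  ext i j
  simp [hv, Matrix.sum_apply, Matrix.mul_apply, Matrix.vecMulVec_apply]

theorem norm_opF_sq {m n : ℕ} (X : Matrix (Fin m) (Fin n) ℂ) (u : Fin n → ℂ) :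
    ‖opF X u‖ ^ 2 = ∑ i, ‖∑ j, X i j * u j‖ ^ 2 := by
  rw [EuclideanSpace.norm_sq_eq]
  rfl

theorem norm_opF_le {m n : ℕ} (X : Matrix (Fin m) (Fin n) ℂ) (u : Fin n → ℂ) :
    ‖opF X u‖ ≤ normF X * ‖u‖ :=
  (LinearMap.toContinuousLinearMap (opF X)).le_opNorm u

theorem normF_nonneg {m n : ℕ} (X : Matrix (Fin m) (Fin n) ℂ) : 0 ≤ normF X := norm_nonneg _

/-- Pairing `Xᴴ X` with the Gram matrix `Bᴴ B` gives the total energy of the images under `F_X` of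
the rows of `B`. -/
theorem pairing_gram {m n : ℕ} {S : Type*} [Fintype S] (X : Matrix (Fin m) (Fin n) ℂ)
    (B : Matrix S (Fin n) ℂ) :
    pairing (X.conjTranspose * X) (B.conjTranspose * B) = ∑ s, ‖opF X (B s)‖ ^ 2 := by
  have h (z : ℂ) : ((‖z‖ ^ 2 : ℝ) : ℂ) = star z * z := by
    rw [Complex.star_def, Complex.conj_mul', Complex.ofReal_pow]
  rw [pairing_apply, ← Complex.ofReal_re (∑ s, _)]
  congr 1
  simp only [norm_opF_sq, Complex.ofReal_sum, h, star_sum, star_mul', Finset.sum_mul_sum,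
    Matrix.mul_apply, Matrix.conjTranspose_apply]
  simp only [← Finset.sum_product', Finset.univ_product_univ]
  let e : Fin n × Fin n × Fin m × S ≃ S × Fin m × Fin n × Fin n :=
    ⟨fun x => (x.2.2.2, x.2.2.1, x.1, x.2.1), fun y => (y.2.2.1, y.2.2.2, y.2.1, y.1),
      fun _ => rfl, fun _ => rfl⟩
  refine Fintype.sum_equiv e _ _ fun x => ?_
  simp only [e, Equiv.coe_fn_mk]
  ring

theorem gram_apply_self {n : ℕ} {S : Type*} [Fintype S] (B : Matrix S (Fin n) ℂ) (j : Fin n) :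
    (B.conjTranspose * B) j j = ((∑ s, ‖B s j‖ ^ 2 : ℝ) : ℂ) := by
  simp [Matrix.mul_apply, Complex.conj_mul']

theorem pairing_vecMulVec {m n : ℕ} (X : Matrix (Fin m) (Fin n) ℂ) (u : Fin n → ℂ) :
    pairing (X.conjTranspose * X) (Matrix.vecMulVec (star u) u) = ‖opF X u‖ ^ 2 := by
  have := pairing_gram X (Matrix.replicateRow Unit u)
  rw [Matrix.vecMulVec_eq Unit]
  exact this.trans (by simp; rfl)

theorem pairing_nonneg {m n : ℕ} (X : Matrix (Fin m) (Fin n) ℂ) {Q : Matrix (Fin n) (Fin n) ℂ}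
    (hQ : Q.PosSemidef) : 0 ≤ pairing (X.conjTranspose * X) Q := by
  obtain ⟨k, B, rfl⟩ := exists_eq_conjTranspose_mul_self hQ
  rw [pairing_gram]
  positivity

/-! ### Unitaries determine the norm of `F_X` -/

theorem mem_unitary_pi {n : ℕ} {u : Fin n → ℂ} : u ∈ unitary (Fin n → ℂ) ↔ ∀ j, ‖u j‖ = 1 := by
  have h (z : ℂ) : (starRingEnd ℂ) z * z = 1 ↔ ‖z‖ = 1 := by
    rw [Complex.conj_mul', ← Complex.ofReal_pow, Complex.ofReal_eq_one]
    exact pow_eq_one_iff_of_nonneg (norm_nonneg z) two_ne_zero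
  simp only [Unitary.mem_iff, funext_iff, Pi.mul_apply, Pi.star_apply, Pi.one_apply, RCLike.star_def,
    mul_comm (u _), h, and_self]

/-- Every point of the closed unit disc is the midpoint of two points of the unit circle. -/
theorem exists_midpoint_circle {z : ℂ} (hz : ‖z‖ ≤ 1) :
    ∃ a b : ℂ, ‖a‖ = 1 ∧ ‖b‖ = 1 ∧ z + z = a + b := by
  obtain ⟨c, hc, hzc⟩ : ∃ c : ℂ, ‖c‖ = 1 ∧ z = ‖z‖ * c := by
    by_cases h : z = 0
    · exact ⟨1, by simp, by simp [h]⟩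
    · have h' : (‖z‖ : ℂ) ≠ 0 := by simpa using h
      exact ⟨z / ‖z‖, by simp [h], by field_simp⟩
  have hs : (0 : ℝ) ≤ 1 - ‖z‖ ^ 2 := by nlinarith [norm_nonneg z]
  have key (y : ℝ) (hy : y ^ 2 = 1 - ‖z‖ ^ 2) : ‖((⟨‖z‖, y⟩ : ℂ)) * c‖ = 1 := by
    rw [norm_mul, hc, mul_one, ← pow_eq_one_iff_of_nonneg (norm_nonneg _) two_ne_zero,
      ← Complex.normSq_eq_norm_sq, Complex.normSq_mk]
    nlinarith
  -- The two points are `‖z‖ ± i√(1 - ‖z‖²)`, rotated by the phase `c` of `z`.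
  refine ⟨_, _, key _ (Real.sq_sqrt hs), key (-√(1 - ‖z‖ ^ 2)) (by rw [neg_sq, Real.sq_sqrt hs]), ?_⟩
  rw [← add_mul]
  nth_rw 1 [hzc]; nth_rw 2 [hzc]
  rw [← add_mul]
  congr 1
  apply Complex.ext <;> simp

theorem normF_le_of_unitary {m n : ℕ} (X : Matrix (Fin m) (Fin n) ℂ) {c : ℝ} (hc : 0 ≤ c)
    (h : ∀ u ∈ unitary (Fin n → ℂ), ‖opF X u‖ ≤ c) : normF X ≤ c := by
  refine ContinuousLinearMap.opNorm_le_of_unit_norm (𝕜 := ℝ) (f := (LinearMap.toContinuousLinearMap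
    (opF X)).restrictScalars ℝ) hc fun u hu => ?_
  choose a b ha hb hab using fun j => exists_midpoint_circle ((norm_le_pi_norm u j).trans hu.le)
  have h1 := h a (mem_unitary_pi.2 ha)
  have h2 := h b (mem_unitary_pi.2 hb)
  have h3 : opF X u + opF X u = opF X a + opF X b := by
    rw [← map_add, ← map_add]
    exact congrArg _ (funext hab)
  have h4 : ‖opF X u + opF X u‖ = 2 * ‖opF X u‖ := by
    rw [← two_smul ℝ, norm_smul]; simp
  have h5 := norm_add_le (opF X a) (opF X b)
  rw [← h3, h4] at h5
  change ‖opF X u‖ ≤ c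
  linarith

theorem norm_opF_le_normF {m n : ℕ} (X : Matrix (Fin m) (Fin n) ℂ) {u : Fin n → ℂ}
    (hu : ∀ j, ‖u j‖ ≤ 1) : ‖opF X u‖ ≤ normF X :=
  (norm_opF_le X u).trans
    (mul_le_of_le_one_right (normF_nonneg X) ((pi_norm_le_iff_of_nonneg zero_le_one).2 hu))

/-! ### The completely bounded norm as an energy bound -/

section CompletelyBounded

open scoped Matrix.Norms.L2Operator

theorem ampNormF_nonneg {m n : ℕ} (X : Matrix (Fin m) (Fin n) ℂ) (k : ℕ) : 0 ≤ ampNormF X k := by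
  unfold ampNormF
  exact ContinuousLinearMap.opNorm_nonneg _

theorem normCbF_nonneg {m n : ℕ} (X : Matrix (Fin m) (Fin n) ℂ) : 0 ≤ normCbF X :=
  Real.iSup_nonneg (ampNormF_nonneg X)

theorem ampNormF_le_normCbF {m n : ℕ} (X : Matrix (Fin m) (Fin n) ℂ) (k : ℕ) :
    ampNormF X k ≤ normCbF X :=
  le_ciSup (bddAbove_ampNormF X) k

theorem l2_opNorm_mulVec_toLp {p q : Type*} [Fintype p] [Fintype q] [DecidableEq q]
    (A : Matrix p q ℂ) (x : q → ℂ) :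
    ‖WithLp.toLp 2 (A.mulVec x)‖ ≤ ‖A‖ * ‖WithLp.toLp 2 x‖ :=
  A.l2_opNorm_mulVec (WithLp.toLp 2 x)

theorem l2_opNorm_le_bound {p q : Type*} [Fintype p] [Fintype q] [DecidableEq q]
    (A : Matrix p q ℂ) {c : ℝ} (hc : 0 ≤ c)
    (h : ∀ x : q → ℂ, ‖WithLp.toLp 2 (A.mulVec x)‖ ≤ c * ‖WithLp.toLp 2 x‖) : ‖A‖ ≤ c :=
  ContinuousLinearMap.opNorm_le_bound _ hc fun x => h x.ofLp

/-- Applying the amplification of `F_X` at `A` to a vector amounts to applying `F_X` to the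
coordinates of the vectors `A_j x`. -/
theorem norm_ampF_mulVec_sq {m n k : ℕ} (X : Matrix (Fin m) (Fin n) ℂ)
    (A : Fin n → Matrix (Fin k) (Fin k) ℂ) (x : Fin k → ℂ) :
    ‖WithLp.toLp 2 ((ampF X k A).mulVec x)‖ ^ 2 =
      ∑ s, ‖opF X (fun j => (A j).mulVec x s)‖ ^ 2 := by
  simp only [norm_opF_sq]
  rw [EuclideanSpace.norm_sq_eq, Fintype.sum_prod_type]
  rw [Finset.sum_comm]
  refine Finset.sum_congr rfl fun s _ => Finset.sum_congr rfl fun i _ => ?_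
  congr 2
  simp only [ampF, LinearMap.coe_mk, AddHom.coe_mk, Matrix.mulVec, dotProduct, Matrix.of_apply,
    Finset.sum_mul, Finset.mul_sum]
  rw [Finset.sum_comm]
  simp only [mul_assoc]

theorem norm_ampF_le {m n k : ℕ} (X : Matrix (Fin m) (Fin n) ℂ)
    (A : Fin n → Matrix (Fin k) (Fin k) ℂ) : ‖ampF X k A‖ ≤ normCbF X * ‖A‖ :=
  ((LinearMap.toContinuousLinearMap (ampF X k)).le_opNorm A).trans
    (mul_le_mul_of_nonneg_right (ampNormF_le_normCbF X k) (norm_nonneg A))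

/-- Each column of `B` becomes an operator sending one fixed basis vector to that column and the
others to zero; its operator norm is the `ℓ²` norm of the column. -/
theorem energy_le_normCbF_fin {m n k : ℕ} (X : Matrix (Fin m) (Fin n) ℂ)
    (B : Matrix (Fin k) (Fin n) ℂ) (hB : ∀ j, ∑ s, ‖B s j‖ ^ 2 ≤ 1) :
    ∑ s, ‖opF X (B s)‖ ^ 2 ≤ normCbF X ^ 2 := by
  rcases Nat.eq_zero_or_pos k with rfl | hk
  · simpa using sq_nonneg _
  let o : Fin k := ⟨0, hk⟩
  let A : Fin n → Matrix (Fin k) (Fin k) ℂ := fun j =>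
    Matrix.vecMulVec (fun s => B s j) (Pi.single o 1)
  have hAx (j : Fin n) (x : Fin k → ℂ) : (A j).mulVec x = fun s => B s j * x o := by
    ext s
    simp [A, Matrix.mulVec, dotProduct, Matrix.vecMulVec_apply, Pi.single_apply]
  have hA : ‖A‖ ≤ 1 := by
    refine (pi_norm_le_iff_of_nonneg zero_le_one).2 fun j =>
      l2_opNorm_le_bound _ zero_le_one fun x => ?_
    rw [one_mul, hAx, ← sq_le_sq₀ (norm_nonneg _) (norm_nonneg _), EuclideanSpace.norm_sq_eq,
      EuclideanSpace.norm_sq_eq]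
    simp only [norm_mul, mul_pow, ← Finset.sum_mul]
    calc _ ≤ 1 * ‖x o‖ ^ 2 := mul_le_mul_of_nonneg_right (hB j) (sq_nonneg _)
      _ = ‖x o‖ ^ 2 := one_mul _
      _ ≤ _ := Finset.single_le_sum (f := fun i => ‖x i‖ ^ 2) (fun i _ => sq_nonneg _)
          (Finset.mem_univ o)
  have h1 := norm_ampF_mulVec_sq X A (Pi.single o 1)
  simp only [hAx, Pi.single_eq_same, mul_one] at h1
  rw [show (∑ s, ‖opF X (B s)‖ ^ 2) = ∑ s, ‖opF X (fun j => B s j)‖ ^ 2 from rfl, ← h1]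
  refine pow_le_pow_left₀ (norm_nonneg _) ?_ 2
  refine (l2_opNorm_mulVec_toLp _ _).trans ?_
  have h2 : ‖WithLp.toLp 2 (Pi.single o (1 : ℂ) : Fin k → ℂ)‖ = 1 := by
    simp
  rw [h2, mul_one]
  exact (norm_ampF_le X A).trans (mul_le_of_le_one_right (normCbF_nonneg X) hA)

/-- The energy of a finite family of vectors with columns in the unit ball of `ℓ²` is controlled
by the completely bounded norm. -/
theorem energy_le_normCbF {m n : ℕ} {S : Type*} [Fintype S] (X : Matrix (Fin m) (Fin n) ℂ)
    (B : Matrix S (Fin n) ℂ) (hB : ∀ j, ∑ s, ‖B s j‖ ^ 2 ≤ 1) :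
    ∑ s, ‖opF X (B s)‖ ^ 2 ≤ normCbF X ^ 2 := by
  let e := Fintype.equivFin S
  have h := energy_le_normCbF_fin X (fun s => B (e.symm s)) fun j => by
    rw [Equiv.sum_comp e.symm fun s => ‖B s j‖ ^ 2]; exact hB j
  rwa [Equiv.sum_comp e.symm fun s => ‖opF X (B s)‖ ^ 2] at h

/-- For fixed `x`, the vectors `A j x` serve as the columns of `B` after division by their common
bound `t = ‖A‖ * ‖x‖`; the case `t = 0` is treated apart. -/
theorem normCbF_le_of_energy {m n : ℕ} (X : Matrix (Fin m) (Fin n) ℂ) {c : ℝ} (hc : 0 ≤ c)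
    (h : ∀ (k : ℕ) (B : Matrix (Fin k) (Fin n) ℂ), (∀ j, ∑ s, ‖B s j‖ ^ 2 ≤ 1) →
      ∑ s, ‖opF X (B s)‖ ^ 2 ≤ c ^ 2) : normCbF X ≤ c := by
  refine ciSup_le fun k => ContinuousLinearMap.opNorm_le_bound _ hc fun A => ?_
  change ‖ampF X k A‖ ≤ c * ‖A‖
  refine l2_opNorm_le_bound _ (by positivity) fun x => ?_
  have hcol (j : Fin n) : ∑ s, ‖(A j).mulVec x s‖ ^ 2 ≤ (‖A‖ * ‖WithLp.toLp 2 x‖) ^ 2 := by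
    have h1 := EuclideanSpace.norm_sq_eq (WithLp.toLp 2 ((A j).mulVec x))
    refine h1.symm.le.trans (pow_le_pow_left₀ (norm_nonneg _) ?_ 2)
    exact (l2_opNorm_mulVec_toLp _ _).trans
      (mul_le_mul_of_nonneg_right (norm_le_pi_norm A j) (norm_nonneg _))
  rw [← sq_le_sq₀ (norm_nonneg _) (by positivity), norm_ampF_mulVec_sq, mul_assoc]
  generalize ht : ‖A‖ * ‖WithLp.toLp 2 x‖ = t at hcol ⊢
  have ht0 : 0 ≤ t := ht ▸ by positivity
  rcases ht0.eq_or_lt with rfl | htpos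
  · have h0 (s : Fin k) : (fun j => (A j).mulVec x s) = 0 := by
      ext j
      have h2 := (Finset.single_le_sum (f := fun s => ‖(A j).mulVec x s‖ ^ 2)
        (fun i _ => sq_nonneg _) (Finset.mem_univ s)).trans (hcol j)
      have h3 : ‖(A j).mulVec x s‖ ^ 2 ≤ 0 := by simpa using h2
      simpa using le_antisymm h3 (sq_nonneg _)
    simp [h0]
  · have h1 := h k (Matrix.of fun s j => (t : ℂ)⁻¹ * (A j).mulVec x s) fun j => by
      simp only [Matrix.of_apply, norm_mul, mul_pow, ← Finset.mul_sum, norm_inv, Complex.norm_real,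
        Real.norm_eq_abs, inv_pow, sq_abs]
      rw [inv_mul_le_one₀ (by positivity)]
      exact hcol j
    have h2 (s : Fin k) : opF X ((Matrix.of fun s j => (t : ℂ)⁻¹ * (A j).mulVec x s) s) =
        (t : ℂ)⁻¹ • opF X (fun j => (A j).mulVec x s) := by
      rw [← map_smul]; rfl
    simp only [h2, norm_smul, mul_pow, ← Finset.mul_sum, norm_inv, Complex.norm_real,
        Real.norm_eq_abs, inv_pow, sq_abs] at h1
    rw [inv_mul_le_iff₀ (by positivity)] at h1
    linarith [mul_pow c t 2]

end CompletelyBounded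

/-! ### Khintchine's inequality for fourth moments -/

section Rademacher

variable {E : Type*} [NormedAddCommGroup E] [InnerProductSpace ℝ E]

theorem norm_add_pow_four_add_norm_sub_pow_four_le (x y : E) :
    ‖x + y‖ ^ 4 + ‖x - y‖ ^ 4 ≤ 2 * (‖x‖ ^ 4 + 6 * ‖x‖ ^ 2 * ‖y‖ ^ 2 + ‖y‖ ^ 4) := by
  have h1 := norm_add_sq_real x y
  have h2 := norm_sub_sq_real x y
  have h3 : inner ℝ x y ^ 2 ≤ (‖x‖ * ‖y‖) ^ 2 :=
    sq_le_sq' (neg_le_of_abs_le (abs_real_inner_le_norm x y)) (real_inner_le_norm x y)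
  rw [show ‖x + y‖ ^ 4 = (‖x + y‖ ^ 2) ^ 2 by ring, show ‖x - y‖ ^ 4 = (‖x - y‖ ^ 2) ^ 2 by ring,
    h1, h2]
  nlinarith

/-- Finite Rademacher systems: a finite family of sign vectors for which random combinations have
the expected second moment and a fourth moment bounded by the Khintchine inequality. -/
theorem exists_rademacher (k : ℕ) :
    ∃ (Ω : Type) (_ : Fintype Ω) (_ : Nonempty Ω) (z : Ω → Fin k → ℝ),
      ∀ (E : Type) [NormedAddCommGroup E] [InnerProductSpace ℝ E] (v : Fin k → E),
        ∑ ω, ‖∑ i, z ω i • v i‖ ^ 2 = Fintype.card Ω * ∑ i, ‖v i‖ ^ 2 ∧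
        ∑ ω, ‖∑ i, z ω i • v i‖ ^ 4 ≤ 3 * Fintype.card Ω * (∑ i, ‖v i‖ ^ 2) ^ 2 := by
  induction k with
  | zero => exact ⟨Unit, inferInstance, inferInstance, fun _ _ => 0, fun E _ _ v => by simp⟩
  | succ k ih =>
    obtain ⟨Ω, _, _, z, hz⟩ := ih
    -- One fresh independent sign is attached to the new vector. The constant 3 survives because
    -- `3(‖a‖² + σ)²` already contains the cross term `6‖a‖²σ`.
    refine ⟨Ω × Bool, inferInstance, inferInstance,
      fun ω => Fin.cons (if ω.2 then 1 else -1) (z ω.1), fun E _ _ v => ?_⟩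
    obtain ⟨h2, h4⟩ := hz E (fun i => v i.succ)
    simp only [Fintype.sum_prod_type, Fintype.sum_bool, Fin.sum_univ_succ, Fin.cons_zero,
      Fin.cons_succ, if_true, Bool.false_eq_true, if_false, one_smul, neg_smul, Fintype.card_prod,
      Fintype.card_bool, Nat.cast_mul, Nat.cast_ofNat]
    generalize (∑ i : Fin k, ‖v i.succ‖ ^ 2) = σ at h2 h4 ⊢
    generalize v 0 = a
    obtain ⟨x, hx⟩ : ∃ x : Ω → E, ∀ ω, ∑ i, z ω i • v i.succ = x ω := ⟨_, fun _ => rfl⟩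
    simp only [hx, add_comm _ (x _), ← sub_eq_add_neg] at h2 h4 ⊢
    have hcard : ∑ _ω : Ω, (1 : ℝ) = Fintype.card Ω := by simp
    constructor
    · have h (ω : Ω) : ‖x ω + a‖ ^ 2 + ‖x ω - a‖ ^ 2 = 2 * ‖x ω‖ ^ 2 + 2 * ‖a‖ ^ 2 * 1 := by
        linarith [parallelogram_law_with_norm ℝ (x ω) a]
      simp only [h, Finset.sum_add_distrib, ← Finset.mul_sum, h2, hcard]
      ring
    · calc ∑ ω, (‖x ω + a‖ ^ 4 + ‖x ω - a‖ ^ 4)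
          ≤ ∑ ω, (2 * ‖x ω‖ ^ 4 + 12 * ‖a‖ ^ 2 * ‖x ω‖ ^ 2 + 2 * ‖a‖ ^ 4 * 1) :=
            Finset.sum_le_sum fun ω _ => by
              linarith [norm_add_pow_four_add_norm_sub_pow_four_le (x ω) a]
        _ ≤ 2 * (3 * Fintype.card Ω * σ ^ 2) + 12 * ‖a‖ ^ 2 * (Fintype.card Ω * σ) +
              2 * ‖a‖ ^ 4 * Fintype.card Ω := by
            simp only [Finset.sum_add_distrib, ← Finset.mul_sum, h2, hcard]
            linarith
        _ ≤ _ := by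
            have : (0 : ℝ) ≤ Fintype.card Ω * ‖a‖ ^ 4 := by positivity
            linarith [show 3 * ((Fintype.card Ω : ℝ) * 2) * (‖a‖ ^ 2 + σ) ^ 2 =
              2 * (3 * Fintype.card Ω * σ ^ 2) + 12 * ‖a‖ ^ 2 * (Fintype.card Ω * σ) +
              6 * (Fintype.card Ω * ‖a‖ ^ 4) by ring]

end Rademacher

/-! ### A finite bound for the little Grothendieck constant -/

theorem energy_le_mul_normCbF_sq {m n : ℕ} {S : Type*} [Fintype S] (X : Matrix (Fin m) (Fin n) ℂ)
    (B : Matrix S (Fin n) ℂ) {t : ℝ} (ht : 0 < t) (hB : ∀ j, ∑ s, ‖B s j‖ ^ 2 ≤ t) :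
    ∑ s, ‖opF X (B s)‖ ^ 2 ≤ t * normCbF X ^ 2 := by
  have hn : ‖((√t : ℝ) : ℂ)⁻¹‖ ^ 2 = t⁻¹ := by
    rw [norm_inv, Complex.norm_real, Real.norm_eq_abs, inv_pow, sq_abs, Real.sq_sqrt ht.le]
  have h1 := energy_le_normCbF X (Matrix.of fun s j => ((√t : ℝ) : ℂ)⁻¹ * B s j) fun j => by
    simp only [Matrix.of_apply, norm_mul, mul_pow, ← Finset.mul_sum, hn]
    rw [inv_mul_le_one₀ ht]
    exact hB j
  have h2 (s : S) : opF X ((Matrix.of fun s j => ((√t : ℝ) : ℂ)⁻¹ * B s j) s) =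
      ((√t : ℝ) : ℂ)⁻¹ • opF X (B s) := by
    rw [← map_smul]; rfl
  simp only [h2, norm_smul, mul_pow, ← Finset.mul_sum, hn] at h1
  rwa [inv_mul_le_iff₀ ht] at h1

/-- A little Grothendieck inequality, obtained by truncating Rademacher sums. -/
theorem normCbF_le_sqrt_mul_normF {m n : ℕ} (X : Matrix (Fin m) (Fin n) ℂ) :
    normCbF X ≤ √48 * normF X := by
  -- A self-improving bound: the truncated part is controlled by `normF X`, the tail by `normCbF X`
  -- again. As `normCbF X` is finite, its half is absorbed on the left.
  have key : normCbF X ≤ √(24 * normF X ^ 2 + normCbF X ^ 2 / 2) := by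
    refine normCbF_le_of_energy X (Real.sqrt_nonneg _) fun k B hB => ?_
    rw [Real.sq_sqrt (by positivity)]
    obtain ⟨Ω, _, _, z, hz⟩ := exists_rademacher k
    have hN : (0 : ℝ) < Fintype.card Ω := by exact_mod_cast Fintype.card_pos
    let G : Ω → Fin n → ℂ := fun ω j => ∑ s, z ω s • B s j
    let T : Ω → Fin n → ℂ := fun ω j => if ‖G ω j‖ ^ 2 ≤ 12 then G ω j else 0
    let R : Ω → Fin n → ℂ := fun ω j => if ‖G ω j‖ ^ 2 ≤ 12 then 0 else G ω j
    have hG (ω : Ω) : opF X (G ω) = ∑ s, z ω s • opF X (B s) := by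
      have h (s : Fin k) : z ω s • opF X (B s) = opF X (z ω s • B s) :=
        ((opF X).map_smul_of_tower (z ω s) (B s)).symm
      simp only [h, ← map_sum]
      congr 1
      ext j
      simp [G]
    have hTR (ω : Ω) : G ω = T ω + R ω := by
      ext j
      by_cases h : ‖G ω j‖ ^ 2 ≤ 12 <;> simp [T, R, h]
    have hT (ω : Ω) : ‖opF X (T ω)‖ ^ 2 ≤ 12 * normF X ^ 2 := by
      have h1 : ‖T ω‖ ≤ √12 := (pi_norm_le_iff_of_nonneg (Real.sqrt_nonneg _)).2 fun j => by
        apply Real.le_sqrt_of_sq_le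
        by_cases h : ‖G ω j‖ ^ 2 ≤ 12 <;> simp [T, h]
      have h2 := pow_le_pow_left₀ (norm_nonneg _)
        ((norm_opF_le X (T ω)).trans (mul_le_mul_of_nonneg_left h1 (normF_nonneg X))) 2
      rw [mul_pow, Real.sq_sqrt (by norm_num)] at h2
      linarith
    -- The tail satisfies `‖R‖² ≤ ‖G‖⁴ / 12`, so the Khintchine constant 3 gives the factor `3 /
    -- 12`.
    have hR : ∑ ω, ‖opF X (R ω)‖ ^ 2 ≤ Fintype.card Ω / 4 * normCbF X ^ 2 := by
      refine energy_le_mul_normCbF_sq X R (by positivity) fun j => ?_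
      have h1 (ω : Ω) : ‖R ω j‖ ^ 2 ≤ ‖G ω j‖ ^ 4 / 12 := by
        by_cases h : ‖G ω j‖ ^ 2 ≤ 12
        · simp only [R, h, if_true, norm_zero]
          rw [zero_pow two_ne_zero]
          positivity
        · simp only [R, h, if_false]
          nlinarith
      have h2 := (hz ℂ fun s => B s j).2
      have h3 : (∑ s, ‖B s j‖ ^ 2) ^ 2 ≤ 1 :=
        pow_le_one₀ (Finset.sum_nonneg fun s _ => sq_nonneg _) (hB j)
      calc ∑ ω, ‖R ω j‖ ^ 2 ≤ ∑ ω, ‖G ω j‖ ^ 4 / 12 := Finset.sum_le_sum fun ω _ => h1 ω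
        _ = (∑ ω, ‖G ω j‖ ^ 4) / 12 := by rw [Finset.sum_div]
        _ ≤ 3 * Fintype.card Ω * (∑ s, ‖B s j‖ ^ 2) ^ 2 / 12 := by gcongr
        _ ≤ 3 * Fintype.card Ω * 1 / 12 := by gcongr
        _ = _ := by ring
    have hsum : Fintype.card Ω * ∑ s, ‖opF X (B s)‖ ^ 2 ≤
        Fintype.card Ω * (24 * normF X ^ 2 + normCbF X ^ 2 / 2) := by
      rw [← (hz (EuclideanSpace ℂ (Fin m)) fun s => opF X (B s)).1]
      calc ∑ ω, ‖∑ s, z ω s • opF X (B s)‖ ^ 2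
          ≤ ∑ ω, (24 * normF X ^ 2 + 2 * ‖opF X (R ω)‖ ^ 2) := by
            refine Finset.sum_le_sum fun ω _ => ?_
            rw [← hG, hTR, map_add]
            have h1 := pow_le_pow_left₀ (norm_nonneg _)
              (norm_add_le (opF X (T ω)) (opF X (R ω))) 2
            nlinarith [hT ω, sq_nonneg (‖opF X (T ω)‖ - ‖opF X (R ω)‖)]
        _ = Fintype.card Ω * (24 * normF X ^ 2) + 2 * ∑ ω, ‖opF X (R ω)‖ ^ 2 := by
            rw [Finset.sum_add_distrib, Finset.sum_const, nsmul_eq_mul, Finset.mul_sum,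
              Finset.card_univ]
        _ ≤ _ := by nlinarith
    exact le_of_mul_le_mul_left hsum hN
  have h0 := normCbF_nonneg X
  have h1 := pow_le_pow_left₀ h0 key 2
  rw [Real.sq_sqrt (by positivity)] at h1
  refine le_of_sq_le_sq ?_ (mul_nonneg (Real.sqrt_nonneg _) (normF_nonneg X))
  rw [mul_pow, Real.sq_sqrt (by norm_num)]
  linarith

/-! ### Convexity, closedness and duality of the cones -/

theorem vecMulVec_mem_setR {n : ℕ} {u : Fin n → ℂ} (hu : u ∈ unitary (Fin n → ℂ)) :
    Matrix.vecMulVec (star u) u ∈ setR n :=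
  subset_closedConvexHull ⟨u, hu, rfl⟩

theorem isClosed_posCone (n : ℕ) : IsClosed (posCone n) := by
  simp only [posCone, Matrix.posSemidef_iff_dotProduct_mulVec, Matrix.IsHermitian, Set.ofPred_and,
    Set.ofPred_forall]
  refine (isClosed_eq (by fun_prop) (by fun_prop)).inter (isClosed_iInter fun x => ?_)
  exact isClosed_le continuous_const (by fun_prop)

theorem convex_posCone (n : ℕ) : Convex ℝ (posCone n) := fun _ hP _ hQ _ _ ha hb _ =>
  (Matrix.PosSemidef.smul hP ha).add (Matrix.PosSemidef.smul hQ hb)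

theorem convex_setR (n : ℕ) : Convex ℝ (setR n) := convex_closedConvexHull

theorem isCompact_setR (n : ℕ) : IsCompact (setR n) := by
  let K : Set (Matrix (Fin n) (Fin n) ℂ) :=
    Set.univ.pi fun _ => Set.univ.pi fun _ => Metric.closedBall 0 1
  have hK : IsCompact K :=
    isCompact_univ_pi fun _ => isCompact_univ_pi fun _ => isCompact_closedBall 0 1
  refine hK.of_isClosed_subset isClosed_closedConvexHull (closedConvexHull_min ?_ ?_ hK.isClosed)
  · rintro _ ⟨u, hu, rfl⟩ i _ j _
    have hu := mem_unitary_pi.1 hu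
    simp [Matrix.vecMulVec_apply, hu]
  · exact convex_pi fun _ _ => convex_pi fun _ _ => convex_closedBall 0 1

/-- A compact set plus a closed set is closed; this permits strict separation. -/
theorem isClosed_smul_setR_sub_posCone (α : ℝ) (n : ℕ) : IsClosed (α • setR n - posCone n) := by
  rw [sub_eq_add_neg]
  exact (isClosed_posCone n).neg.add_left_of_isCompact ((isCompact_setR n).smul α)

theorem pairing_le_of_mem_setR {m n : ℕ} (X : Matrix (Fin m) (Fin n) ℂ)
    {R : Matrix (Fin n) (Fin n) ℂ} (hR : R ∈ setR n) :
    pairing (X.conjTranspose * X) R ≤ normF X ^ 2 := by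
  have h : setR n ⊆ {R | pairing (X.conjTranspose * X) R ≤ normF X ^ 2} := by
    refine closedConvexHull_min ?_ (convex_halfSpace_le (pairing _).isLinear _)
      (isClosed_le (continuous_pairing _) continuous_const)
    rintro _ ⟨u, hu, rfl⟩
    rw [Set.mem_ofPred_eq, pairing_vecMulVec]
    exact pow_le_pow_left₀ (norm_nonneg _)
      (norm_opF_le_normF X fun j => (mem_unitary_pi.1 hu j).le) 2
  exact h hR

/-- Every real linear functional on matrices is, on Hermitian matrices, the pairing with a
Hermitian matrix. -/
theorem exists_pairing_eq {n : ℕ} (f : Matrix (Fin n) (Fin n) ℂ →ₗ[ℝ] ℝ) :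
    ∃ P : Matrix (Fin n) (Fin n) ℂ, P.IsHermitian ∧ ∀ Q, Q.IsHermitian → f Q = pairing P Q := by
  let P : Matrix (Fin n) (Fin n) ℂ := Matrix.of fun j l =>
    ⟨f (Matrix.single j l 1), -f (Matrix.single j l Complex.I)⟩
  have hP (Q : Matrix (Fin n) (Fin n) ℂ) : f Q = pairing P Q := by
    conv_lhs => rw [Matrix.matrix_eq_sum_single Q]
    simp only [map_sum, pairing_apply, Complex.re_sum]
    refine Finset.sum_congr rfl fun j _ => Finset.sum_congr rfl fun l _ => ?_
    have h : Matrix.single j l (Q j l) = (Q j l).re • Matrix.single j l (1 : ℂ) +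
        (Q j l).im • Matrix.single j l Complex.I := by
      rw [Matrix.smul_single, Matrix.smul_single, ← Matrix.single_add]
      congr 1
      simp [Complex.re_add_im]
    rw [h, map_add, map_smul, map_smul]
    simp [P]
    ring
  have hPH (Q : Matrix (Fin n) (Fin n) ℂ) (hQ : Q.IsHermitian) :
      pairing P.conjTranspose Q = pairing P Q := by
    rw [pairing_apply, pairing_apply, ← Complex.conj_re, map_sum, Finset.sum_comm]
    simp only [map_sum]
    rw [Finset.sum_comm]
    congr 1
    rw [Finset.sum_comm]
    refine Finset.sum_congr rfl fun j _ => Finset.sum_congr rfl fun l _ => ?_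
    have := hQ.apply l j
    simp only [RCLike.star_def] at this
    simp [this]
  -- Against Hermitian matrices `P` and its adjoint pair equally, so their average represents `f`
  -- too.
  refine ⟨(1 / 2 : ℝ) • (P + P.conjTranspose), ?_, fun Q hQ => ?_⟩
  · rw [Matrix.IsHermitian, Matrix.conjTranspose_smul, Matrix.conjTranspose_add,
      Matrix.conjTranspose_conjTranspose, add_comm, star_trivial]
  · have h : pairing ((1 / 2 : ℝ) • (P + P.conjTranspose)) Q =
        1 / 2 * (pairing P Q + pairing P.conjTranspose Q) := by
      simp only [pairing_apply, Complex.re_sum, ← Finset.sum_add_distrib, Finset.mul_sum]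
      refine Finset.sum_congr rfl fun j _ => Finset.sum_congr rfl fun l _ => ?_
      rw [Matrix.smul_apply, smul_mul_assoc, Complex.smul_re, Matrix.add_apply, add_mul,
        Complex.add_re, smul_eq_mul]
    rw [h, hPH Q hQ, hP]
    ring

theorem posSemidef_of_pairing_nonneg {n : ℕ} {P : Matrix (Fin n) (Fin n) ℂ} (hP : P.IsHermitian)
    (h : ∀ Q, Q.PosSemidef → 0 ≤ pairing P Q) : P.PosSemidef := by
  refine Matrix.posSemidef_iff_dotProduct_mulVec.2 ⟨hP, fun x => ?_⟩
  have h1 := h _ (Matrix.posSemidef_vecMulVec_star_self x)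
  have h2 : ∑ j, ∑ l, P j l * Matrix.vecMulVec (star x) x j l = dotProduct (star x) (P.mulVec x) := by
    simp only [dotProduct, Matrix.mulVec, Finset.mul_sum, Matrix.vecMulVec_apply]
    exact Finset.sum_congr rfl fun j _ => Finset.sum_congr rfl fun l _ => by ring
  rw [pairing_apply, h2] at h1
  exact Complex.nonneg_iff.2 ⟨h1, (hP.im_star_dotProduct_mulVec_self x).symm⟩

/-! ### The two implications and attainment of the constant -/

theorem normCbF_le_of_setQ_subset {β : ℝ} {n : ℕ} (hβ : 0 ≤ β)
    (h : setQ n ⊆ β • setR n - posCone n) {m : ℕ} (X : Matrix (Fin m) (Fin n) ℂ) :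
    normCbF X ≤ √β * normF X := by
  refine normCbF_le_of_energy X (mul_nonneg (Real.sqrt_nonneg _) (normF_nonneg X)) fun k B hB => ?_
  rw [mul_pow, Real.sq_sqrt hβ, ← pairing_gram]
  -- Padding the diagonal up to 1 moves the Gram matrix into `setQ n` and can only increase the
  -- pairing.
  let d : Fin n → ℂ := fun j => ((1 - ∑ s, ‖B s j‖ ^ 2 : ℝ) : ℂ)
  have hd : (Matrix.diagonal d).PosSemidef := Matrix.PosSemidef.diagonal fun j =>
    Complex.zero_le_real.2 (sub_nonneg.2 (hB j))
  have hQ : B.conjTranspose * B + Matrix.diagonal d ∈ setQ n := by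
    refine ⟨(Matrix.posSemidef_conjTranspose_mul_self B).add hd, ?_⟩
    ext j
    simp [gram_apply_self, d]
  obtain ⟨_, ⟨R, hR, rfl⟩, p, hp, hRp⟩ := h hQ
  have h1 := congrArg (pairing (X.conjTranspose * X)) hRp
  simp only [map_sub, map_add, map_smul, smul_eq_mul] at h1
  have h2 := pairing_nonneg X hd
  have h3 := pairing_nonneg X hp
  have h4 := mul_le_mul_of_nonneg_left (pairing_le_of_mem_setR X hR) hβ
  linarith

theorem setQ_subset_of_normCbF_le {α : ℝ} {n : ℕ} (hα : 0 < α)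
    (h : ∀ (m : ℕ) (X : Matrix (Fin m) (Fin n) ℂ), normCbF X ≤ √α * normF X) :
    setQ n ⊆ α • setR n - posCone n := by
  intro Q hQ
  by_contra hmem
  have : LocallyConvexSpace ℝ (Matrix (Fin n) (Fin n) ℂ) :=
    inferInstanceAs (LocallyConvexSpace ℝ (Fin n → Fin n → ℂ))
  obtain ⟨f, t, hft, htQ⟩ := geometric_hahn_banach_closed_point
    (((convex_setR n).smul α).sub (convex_posCone n)) (isClosed_smul_setR_sub_posCone α n) hmem
  have hneg {R p : Matrix (Fin n) (Fin n) ℂ} (hR : R ∈ setR n) (hp : p.PosSemidef) :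
      α * f R - f p < t := by
    have := hft _ (Set.sub_mem_sub (Set.smul_mem_smul_set hR) hp)
    simpa only [map_sub, map_smul, smul_eq_mul] using this
  have hone : Matrix.vecMulVec (star 1) 1 ∈ setR n := vecMulVec_mem_setR (one_mem _)
  -- If `f p < 0`, subtracting large multiples of `p` would make `f` unbounded above on the set.
  have hpos (p : Matrix (Fin n) (Fin n) ℂ) (hp : p.PosSemidef) : 0 ≤ f p := by
    by_contra! hlt
    obtain ⟨N, hN⟩ := exists_nat_gt ((t - α * f (Matrix.vecMulVec (star 1) 1)) / -f p)
    rw [div_lt_iff₀ (by linarith)] at hN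
    have := hneg hone (hp.smul (Nat.cast_nonneg (α := ℝ) N))
    rw [map_smul, smul_eq_mul] at this
    linarith
  obtain ⟨P, hPherm, hP⟩ := exists_pairing_eq f.toLinearMap
  have hPpsd : P.PosSemidef := posSemidef_of_pairing_nonneg hPherm fun p hp =>
    hP p hp.isHermitian ▸ hpos p hp
  obtain ⟨k, X, hX⟩ := exists_eq_conjTranspose_mul_self hPpsd
  obtain ⟨l, B, rfl⟩ := exists_eq_conjTranspose_mul_self hQ.1
  have hPH (p : Matrix (Fin n) (Fin n) ℂ) (hp : p.PosSemidef) :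
      f p = pairing (X.conjTranspose * X) p := hX ▸ hP p hp.isHermitian
  have hu (u : Fin n → ℂ) (hu : u ∈ unitary (Fin n → ℂ)) : ‖opF X u‖ ^ 2 ≤ t / α := by
    rw [← pairing_vecMulVec, ← hPH _ (Matrix.posSemidef_vecMulVec_star_self u), le_div_iff₀' hα]
    simpa using (hneg (vecMulVec_mem_setR hu) Matrix.PosSemidef.zero).le
  have ht : 0 ≤ t / α := (sq_nonneg _).trans (hu 1 (one_mem _))
  have hF : normF X ≤ √(t / α) :=
    normF_le_of_unitary X (Real.sqrt_nonneg _) fun u h => Real.le_sqrt_of_sq_le (hu u h)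
  have hF2 := pow_le_pow_left₀ (normF_nonneg X) hF 2
  rw [Real.sq_sqrt ht, le_div_iff₀' hα] at hF2
  have hB (j : Fin n) : ∑ s, ‖B s j‖ ^ 2 ≤ 1 := by
    have := congrFun hQ.2 j
    rw [Matrix.diag_apply, gram_apply_self, Pi.one_apply, Complex.ofReal_eq_one] at this
    exact this.le
  have hcb := pow_le_pow_left₀ (normCbF_nonneg X) (h k X) 2
  rw [mul_pow, Real.sq_sqrt hα.le] at hcb
  have hE := energy_le_normCbF X B hB
  rw [← pairing_gram, ← hPH _ hQ.1] at hE
  linarith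

/-- The admissible set is nonempty and bounded below by 1 (test the 1 × 1 identity), and each
inequality is closed in `κ`, so the infimum is attained and positive. -/
theorem kG_mem :
    0 < kG ∧ ∀ (m n : ℕ) (X : Matrix (Fin m) (Fin n) ℂ), normCbF X ≤ √kG * normF X := by
  let K : Set ℝ := {κ : ℝ | 0 < κ ∧ ∀ (m n : ℕ) (X : Matrix (Fin m) (Fin n) ℂ),
    normCbF X ≤ √κ * normF X}
  have hne : K.Nonempty := ⟨48, by norm_num, fun m n X => normCbF_le_sqrt_mul_normF X⟩
  have hone : ∀ κ ∈ K, 1 ≤ κ := by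
    rintro κ ⟨-, hκ⟩
    have h1 := hκ 1 1 1
    have h2 : (1 : ℝ) ≤ normCbF (1 : Matrix (Fin 1) (Fin 1) ℂ) := by
      have := energy_le_normCbF (1 : Matrix (Fin 1) (Fin 1) ℂ) (1 : Matrix (Fin 1) (Fin 1) ℂ)
        (by simp)
      simp only [Finset.univ_unique, Finset.sum_singleton, norm_opF_sq] at this
      refine (one_le_sq_iff₀ (normCbF_nonneg _)).1 (le_trans ?_ this)
      simp
    have h3 : normF (1 : Matrix (Fin 1) (Fin 1) ℂ) ≤ 1 :=
      normF_le_of_unitary _ zero_le_one fun u hu => by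
        rw [← sq_le_one_iff₀ (norm_nonneg _), norm_opF_sq]
        simp [mem_unitary_pi.1 hu 0]
    have h4 : 1 ≤ √κ := h2.trans (h1.trans (mul_le_of_le_one_right (Real.sqrt_nonneg _) h3))
    exact Real.one_le_sqrt.1 h4
  refine ⟨zero_lt_one.trans_le (le_csInf hne hone), fun m n X => ?_⟩
  have hclosed : IsClosed {κ : ℝ | normCbF X ≤ √κ * normF X} :=
    isClosed_le continuous_const (by fun_prop)
  exact closure_minimal (fun κ (hκ : κ ∈ K) => hκ.2 m n X) hclosed (csInf_mem_closure hne ⟨1, hone⟩)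

end LittleGrothendieck

theorem mainTheorem2 :
    IsLeast
      {β : ℝ | 0 < β ∧ ∀ n : ℕ, ∀ α : ℝ, β ≤ α →
        LittleGrothendieck.setQ n ⊆
          α • LittleGrothendieck.setR n - LittleGrothendieck.posCone n}
      LittleGrothendieck.kG := by
  obtain ⟨hpos, hkG⟩ := LittleGrothendieck.kG_mem
  refine ⟨⟨hpos, fun n α hα => ?_⟩, fun β hβ => ?_⟩
  · exact LittleGrothendieck.setQ_subset_of_normCbF_le (hpos.trans_le hα) fun m X =>
      (hkG m n X).trans (mul_le_mul_of_nonneg_right (Real.sqrt_le_sqrt hα)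
        (LittleGrothendieck.normF_nonneg X))
  · exact csInf_le ⟨0, fun κ hκ => hκ.1.le⟩ ⟨hβ.1, fun m n X =>
      LittleGrothendieck.normCbF_le_of_setQ_subset hβ.1.le (hβ.2 n β le_rfl) X⟩
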